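/- Let $n\ge 0$, $T>0$, let $H_0,H_1$ be traceless skew-Hermitian complex $n\times n$ matrices and let $\rho_0,\theta$ be Hermitian $n\times n$ matrices. For a control $u\in\mathcal H:=L^2([0,T],\mathbb R)$ let $\rho$ be the (Carathéodory) solution of $$\dot\rho(t)=[H_0+u(t)H_1,\rho(t)]\quad (t\in[0,T]),\qquad \rho(0)=\rho_0,$$ where $[A,B]=AB-BA$, and put $\mathrm{End}_{\rho_0}(u):=\rho(T)$. It lies in the unitary orbit $\mathcal O(\rho_0)=\{U\rho_0U^\dagger : U\in \mathrm{SU}(n)\}$, a compact embedded submanifold of $\mathbb C^{n\times n}$. Let $J(\rho)=\mathrm{Re}\,\mathrm{tr}(\rho\theta)$ for $\rho\in\mathcal O(\rho_0)$ and $\mathcal J(u)=J(\mathrm{End}_{\rho_0}(u))$ for $u\in\mathcal H$. A control $u$ is called regular if the rank of the differential $d\,\mathrm{End}_{\rho_0}(u)$ equals $\dim\mathcal O(\rho_0)$. If $u\in\mathcal H$ is a regular control, then the following are equivalent: (a) $u$ is a critical point of $\mathcal J$, i.e. $d\mathcal J(u)=0$; (b) $\mathrm{End}_{\rho_0}(u)$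 is a critical point of $J$ on $\mathcal O(\rho_0)$, i.e. $dJ(\mathrm{End}_{\rho_0}(u))$ vanishes on the tangent space of $\mathcal O(\rho_0)$ at $\mathrm{End}_{\rho_0}(u)$; (c) $[\mathrm{End}_{\rho_0}(u),\theta]=0$. -/

import Mathlib

open MeasureTheory
open scoped Matrix Matrix.Norms.Frobenius

noncomputable section

namespace QuantumControl

variable {n : ℕ}

/-- The complex `n × n` matrices. As a real normed space it carries the Frobenius
(Hilbert–Schmidt) norm; all norms are equivalent, so none of the notions below depends on this. -/
abbrev Mat (n : ℕ) : Type := Matrix (Fin n) (Fin n) ℂ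

/-- `𝔰𝔲(n)`: the traceless skew-Hermitian matrices. -/
def IsSu (A : Mat n) : Prop := Aᴴ = -A ∧ A.trace = 0

/-- The Hilbert space of controls `L²([0,T], ℝ)`. -/
abbrev Control (T : ℝ) : Type := Lp ℝ 2 (volume.restrict (Set.Icc (0 : ℝ) T))

/-- `ρ` is, on `[0,T]`, the (Carathéodory) solution of the Liouville–von Neumann equation
`ρ'(t) = [H₀ + u(t) H₁, ρ(t)]`, `ρ(0) = ρ₀`, i.e. a continuous solution of the integrated
equation. Only the almost everywhere class of `u` on `[0,T]` and the values of `ρ` on `[0,T]`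
matter. -/
def IsTrajectory (T : ℝ) (H₀ H₁ ρ₀ : Mat n) (u : Control T) (ρ : ℝ → Mat n) : Prop :=
  ContinuousOn ρ (Set.Icc 0 T) ∧
    ∀ t ∈ Set.Icc 0 T, ρ t = ρ₀ + ∫ s in (0 : ℝ)..t, ⁅H₀ + (u s : ℝ) • H₁, ρ s⁆

/-- The trajectory of the control `u` (it exists, and it is unique on `[0,T]`). -/
def trajectory (T : ℝ) (H₀ H₁ ρ₀ : Mat n) (u : Control T) : ℝ → Mat n :=
  Classical.epsilon (IsTrajectory T H₀ H₁ ρ₀ u)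

/-- The end-point map `u ↦ ρ(T)`, regarded as a map into the ambient space of matrices. -/
def endPoint (T : ℝ) (H₀ H₁ ρ₀ : Mat n) (u : Control T) : Mat n :=
  trajectory T H₀ H₁ ρ₀ u T

/-- The unitary orbit `{U ρ₀ U† : U ∈ SU(n)}`. -/
def orbit (ρ₀ : Mat n) : Set (Mat n) :=
  {ρ | ∃ U ∈ Matrix.specialUnitaryGroup (Fin n) ℂ, ρ = U * ρ₀ * Uᴴ}

/-- The tangent space at `ρ` of the orbit, an embedded submanifold of the space of matrices:
the real span of the velocities at `ρ` of the curves that run in the orbit. -/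
def tangentSpace (ρ₀ ρ : Mat n) : Submodule ℝ (Mat n) :=
  Submodule.span ℝ
    {η | ∃ γ : ℝ → Mat n, (∀ s, γ s ∈ orbit ρ₀) ∧ γ 0 = ρ ∧ HasDerivAt γ η 0}

/-- The dimension of the orbit. The orbit is homogeneous, so that the tangent space
may be taken at `ρ₀`. -/
def orbitDim (ρ₀ : Mat n) : ℕ := Module.finrank ℝ (tangentSpace ρ₀ ρ₀)

/-- The cost function `J(ρ) = Re tr(ρ θ)`. -/
def cost (θ ρ : Mat n) : ℝ := (ρ * θ).trace.re

/-- The cost function `𝒥(u) = Re tr(End(u) θ)` on the space of controls. -/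
def controlCost (T : ℝ) (H₀ H₁ ρ₀ θ : Mat n) (u : Control T) : ℝ :=
  cost θ (endPoint T H₀ H₁ ρ₀ u)

/-- The control `u` is regular: the rank of the differential at `u` of the end-point map is the
dimension of the orbit. -/
def IsRegular (T : ℝ) (H₀ H₁ ρ₀ : Mat n) (u : Control T) : Prop :=
  Module.finrank ℝ (LinearMap.range (fderiv ℝ (endPoint T H₀ H₁ ρ₀) u).toLinearMap) =
    orbitDim ρ₀

/-- `u` is a critical point of `𝒥`: `𝒥` is Fréchet differentiable at `u`, with derivative `0`. -/
def IsCriticalControl (T : ℝ) (H₀ H₁ ρ₀ θ : Mat n) (u : Control T) : Prop :=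
  HasFDerivAt (controlCost T H₀ H₁ ρ₀ θ) (0 : Control T →L[ℝ] ℝ) u

/-- `ρ` is a critical point of the restriction of `J` to the orbit: it is a point of the orbit and
the differential of `J` at `ρ` vanishes on the tangent space of the orbit. -/
def IsCriticalState (ρ₀ θ ρ : Mat n) : Prop :=
  ρ ∈ orbit ρ₀ ∧ ∀ η ∈ tangentSpace ρ₀ ρ, fderiv ℝ (cost θ) ρ η = 0

end QuantumControl

end

/-!
The solution of a linear equation `x' = A(t) x` with integrable coefficient `A` is
`(1 - V)⁻¹ x₀`, where `V` is the Volterra operator `x ↦ ∫₀ᵗ A(s) x(s) ds`. Some power of `V` is a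
contraction, so the inverse exists, and it depends differentiably on `A`; hence the end-point map
is differentiable. Conjugating by the propagator, which is unitary because `H₀ + u(t) H₁` is
skew-Hermitian, shows that it takes its values in the orbit of `ρ₀`, so its differential maps into
the tangent space of the orbit, and onto it exactly when `u` is regular. By the chain rule `u` is
then critical for `𝒥` if and only if `End(u)` is critical for `J`.

The tangent space at `ρ` contains the `[A, ρ]` with `A` skew-Hermitian, and by compactness of the
unitary group every tangent vector is a commutator with `ρ`. Since
`tr([A, ρ] θ) = tr(A [ρ, θ])`, where `[ρ, θ]` is itself skew-Hermitian, and since `Re tr(A A)` is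
negative definite on skew-Hermitian matrices, `ρ` is critical for `J` if and only if `[ρ, θ] = 0`.
-/

noncomputable section

namespace QuantumControl

open Set Filter Topology

section AbsolutelyContinuous

variable {E F G : Type*} [NormedAddCommGroup E] [NormedSpace ℝ E]
  [NormedAddCommGroup F] [NormedSpace ℝ F] [NormedAddCommGroup G] [NormedSpace ℝ G] {a b c : ℝ}

lemma absolutelyContinuousOnInterval_intervalIntegral {f : ℝ → E}
    (hf : IntervalIntegrable f volume a b) (hc : c ∈ uIcc a b) :
    AbsolutelyContinuousOnInterval (fun x ↦ ∫ t in c..x, f t) a b := by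
  have hnorm := hf.norm.absolutelyContinuousOnInterval_intervalIntegral hc
  have integrable_of_mem {x : ℝ} (hx : x ∈ uIcc a b) : IntervalIntegrable f volume c x :=
    hf.mono_set (uIcc_subset_uIcc hc hx)
  refine squeeze_zero' (.of_forall fun _ ↦ Finset.sum_nonneg fun _ _ ↦ dist_nonneg) ?_ hnorm
  rw [eventually_inf_principal]
  filter_upwards with I hI
  refine Finset.sum_le_sum fun i hi ↦ ?_
  have h₁ := integrable_of_mem (hI.1 i hi).1
  have h₂ := integrable_of_mem (hI.1 i hi).2
  rw [dist_eq_norm, Real.dist_eq, intervalIntegral.integral_interval_sub_left h₁ h₂,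
    intervalIntegral.integral_interval_sub_left h₁.norm h₂.norm]
  exact intervalIntegral.norm_integral_le_abs_integral_norm

lemma absolutelyContinuousOnInterval_bilin (B : E →L[ℝ] F →L[ℝ] G) {f : ℝ → E} {g : ℝ → F}
    (hf : AbsolutelyContinuousOnInterval f a b) (hg : AbsolutelyContinuousOnInterval g a b) :
    AbsolutelyContinuousOnInterval (fun x ↦ B (f x) (g x)) a b := by
  obtain ⟨C, hC⟩ := hf.exists_bound
  obtain ⟨D, hD⟩ := hg.exists_bound
  have dist_le : ∀ x ∈ uIcc a b, ∀ y ∈ uIcc a b, dist (B (f x) (g x)) (B (f y) (g y)) ≤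
      ‖B‖ * C * dist (g x) (g y) + ‖B‖ * D * dist (f x) (f y) := fun x hx y hy ↦
    calc dist (B (f x) (g x)) (B (f y) (g y))
        = ‖B (f x) (g x - g y) + B (f x - f y) (g y)‖ := by
          rw [dist_eq_norm]; simp only [map_sub, sub_apply]; congr 1; abel
      _ ≤ ‖B‖ * ‖f x‖ * ‖g x - g y‖ + ‖B‖ * ‖f x - f y‖ * ‖g y‖ :=
          norm_add_le_of_le (B.le_opNorm₂ _ _) (B.le_opNorm₂ _ _)
      _ ≤ ‖B‖ * C * ‖g x - g y‖ + ‖B‖ * ‖f x - f y‖ * D := by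
          gcongr
          exacts [hC x hx, hD y hy]
      _ = ‖B‖ * C * dist (g x) (g y) + ‖B‖ * D * dist (f x) (f y) := by
          rw [dist_eq_norm, dist_eq_norm]; ring
  have hlim := (Tendsto.const_mul (‖B‖ * C) hg).add (Tendsto.const_mul (‖B‖ * D) hf)
  rw [mul_zero, mul_zero, add_zero] at hlim
  refine squeeze_zero' (.of_forall fun _ ↦ Finset.sum_nonneg fun _ _ ↦ dist_nonneg) ?_ hlim
  rw [eventually_inf_principal]
  filter_upwards with I hI
  rw [Finset.mul_sum, Finset.mul_sum, ← Finset.sum_add_distrib]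
  exact Finset.sum_le_sum fun i hi ↦ dist_le _ (hI.1 i hi).1 _ (hI.1 i hi).2

lemma absolutelyContinuousOnInterval_star {E : Type*} [SeminormedAddCommGroup E]
    [StarAddMonoid E] [NormedStarGroup E] {f : ℝ → E}
    (hf : AbsolutelyContinuousOnInterval f a b) :
    AbsolutelyContinuousOnInterval (fun x ↦ star (f x)) a b := by
  simpa only [AbsolutelyContinuousOnInterval, dist_star_star] using hf

lemma integral_mul_integral_pow {f : ℝ → ℝ} (hf : IntervalIntegrable f volume a b) (k : ℕ) :
    ∫ x in a..b, f x * (∫ t in a..x, f t) ^ k = (∫ x in a..b, f x) ^ (k + 1) / (k + 1) := by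
  set F : ℝ → ℝ := fun x ↦ ∫ t in a..x, f t
  have hF : AbsolutelyContinuousOnInterval F a b :=
    hf.absolutelyContinuousOnInterval_intervalIntegral left_mem_uIcc
  have hpow : ∀ m : ℕ, AbsolutelyContinuousOnInterval (fun x ↦ F x ^ m) a b := by
    intro m
    induction m with
    | zero => simpa [AbsolutelyContinuousOnInterval] using tendsto_const_nhds
    | succ m ih => simpa only [pow_succ] using ih.fun_mul hF
  have hderiv : ∀ᵐ x, x ∈ uIcc a b →
      deriv (fun x ↦ F x ^ (k + 1)) x = (k + 1) * (f x * F x ^ k) := by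
    filter_upwards [hf.ae_hasDerivAt_integral] with x hx hxab
    rw [((hx hxab a left_mem_uIcc).fun_pow (k + 1)).deriv]
    push_cast [Nat.add_sub_cancel]; ring
  have hint := (hpow (k + 1)).integral_deriv_eq_sub
  rw [intervalIntegral.integral_congr_ae (g := fun x ↦ (k + 1) * (f x * F x ^ k))
    (hderiv.mono fun x hx hxab ↦ hx (uIoc_subset_uIcc hxab)),
    intervalIntegral.integral_const_mul] at hint
  rw [eq_div_iff (by positivity), mul_comm, hint]
  simp [F]

end AbsolutelyContinuous

section Caratheodory

variable {E F : Type*} [NormedAddCommGroup E] [NormedSpace ℝ E]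
  [NormedAddCommGroup F] [NormedSpace ℝ F] {T : ℝ}

/-- `x` is, on `[0,T]`, a Carathéodory solution of the differential equation `x' = f(t, x)`,
`x(0) = x₀`, encoded as a continuous solution of the integrated equation. -/
def IsCaratheodorySolution (T : ℝ) (f : ℝ → E → E) (x₀ : E) (x : ℝ → E) : Prop :=
  ContinuousOn x (Icc 0 T) ∧ ∀ t ∈ Icc 0 T, x t = x₀ + ∫ s in (0 : ℝ)..t, f s (x s)

lemma intervalIntegral_congr_ae_restrict_Icc {f g : ℝ → E}
    (hfg : f =ᵐ[volume.restrict (Icc 0 T)] g) {t : ℝ} (ht : t ∈ Icc 0 T) :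
    ∫ s in (0 : ℝ)..t, f s = ∫ s in (0 : ℝ)..t, g s := by
  refine intervalIntegral.integral_congr_ae_restrict
    (ae_restrict_of_ae_restrict_of_subset ?_ hfg)
  rw [uIoc_of_le ht.1]
  exact fun s hs ↦ ⟨hs.1.le, hs.2.trans ht.2⟩

lemma integrableOn_clm_apply {A : ℝ → E →L[ℝ] F} (hA : IntegrableOn A (Icc 0 T))
    {x : ℝ → E} (hx : ContinuousOn x (Icc 0 T)) :
    IntegrableOn (fun s ↦ A s (x s)) (Icc 0 T) := by
  obtain ⟨C, hC⟩ := isCompact_Icc.exists_bound_of_continuousOn hx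
  exact (ContinuousLinearMap.id ℝ (E →L[ℝ] F)).integrable_of_bilin_of_bdd_right C hA
    (hx.aestronglyMeasurable_of_isCompact isCompact_Icc measurableSet_Icc)
    ((ae_restrict_iff' measurableSet_Icc).2 (.of_forall hC))

namespace IsCaratheodorySolution

variable {f g : ℝ → E → E} {x₀ : E} {x : ℝ → E}

lemma congr_ae (hx : IsCaratheodorySolution T f x₀ x)
    (hfg : ∀ᵐ s ∂volume.restrict (Icc 0 T), f s = g s) : IsCaratheodorySolution T g x₀ x :=
  ⟨hx.1, fun t ht ↦ (hx.2 t ht).trans <| congrArg (x₀ + ·) <|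
    intervalIntegral_congr_ae_restrict_Icc (hfg.mono fun s hs ↦ congrFun hs (x s)) ht⟩

lemma apply_zero (hT : 0 ≤ T) (hx : IsCaratheodorySolution T f x₀ x) : x 0 = x₀ := by
  simpa only [intervalIntegral.integral_same, add_zero] using hx.2 0 ⟨le_rfl, hT⟩

lemma absolutelyContinuousOnInterval (hT : 0 ≤ T) (hx : IsCaratheodorySolution T f x₀ x)
    (hf : IntegrableOn (fun s ↦ f s (x s)) (Icc 0 T)) :
    AbsolutelyContinuousOnInterval x 0 T := by
  rw [← uIcc_of_le hT] at hf
  refine (absolutelyContinuousOnInterval_intervalIntegral hf.intervalIntegrable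
    left_mem_uIcc).congr' ?_
  rw [EventuallyEq, eventually_inf_principal]
  filter_upwards with I hI
  refine Finset.sum_congr rfl fun i hi ↦ ?_
  have hI := hI.1 i hi
  rw [uIcc_of_le hT] at hI
  rw [hx.2 _ hI.1, hx.2 _ hI.2, dist_add_left]

lemma ae_hasDerivAt [CompleteSpace E] (hT : 0 ≤ T) (hx : IsCaratheodorySolution T f x₀ x)
    (hf : IntegrableOn (fun s ↦ f s (x s)) (Icc 0 T)) :
    ∀ᵐ t, t ∈ Icc 0 T → HasDerivAt x (f t (x t)) t := by
  rw [← uIcc_of_le hT] at hf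
  have hne (a : ℝ) : ∀ᵐ t : ℝ, t ≠ a := compl_mem_ae_iff.2 (measure_singleton a)
  filter_upwards [hf.intervalIntegrable.ae_hasDerivAt_integral, hne 0, hne T]
    with t hderiv ht₀ htT ht
  rw [uIcc_of_le hT] at hderiv
  refine ((hderiv ht 0 (left_mem_Icc.2 hT)).const_add x₀).congr_of_eventuallyEq ?_
  filter_upwards [Icc_mem_nhds (lt_of_le_of_ne ht.1 ht₀.symm) (lt_of_le_of_ne ht.2 htT)]
    using hx.2

end IsCaratheodorySolution

section Volterra

variable {G : Type*} [NormedAddCommGroup G]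

/-- The Banach space `L¹([0,T], F)`, from which the coefficients of linear equations are taken. -/
abbrev Coefficient (T : ℝ) (F : Type*) [NormedAddCommGroup F] : Type _ :=
  Lp F 1 (volume.restrict (Icc (0 : ℝ) T))

lemma continuousOn_clm_integral (hT : 0 ≤ T) {A : ℝ → E →L[ℝ] F} (hA : IntegrableOn A (Icc 0 T))
    {x : ℝ → E} (hx : ContinuousOn x (Icc 0 T)) :
    ContinuousOn (fun t ↦ ∫ s in (0 : ℝ)..t, A s (x s)) (Icc 0 T) := by
  simpa only [uIcc_of_le hT] using intervalIntegral.continuousOn_primitive_interval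
    ((integrableOn_clm_apply hA hx).mono_set (uIcc_of_le hT).subset)

lemma intervalIntegrable_clm_apply {A : ℝ → E →L[ℝ] F}
    (hA : IntegrableOn A (Icc 0 T)) {x : ℝ → E} (hx : ContinuousOn x (Icc 0 T)) {t : ℝ}
    (ht : t ∈ Icc 0 T) : IntervalIntegrable (fun s ↦ A s (x s)) volume 0 t :=
  ((integrableOn_clm_apply hA hx).mono_set
    ((uIcc_of_le ht.1).trans_subset (Icc_subset_Icc_right ht.2))).intervalIntegrable

lemma norm_integral_clm_apply_le {A : ℝ → E →L[ℝ] F} (hA : IntegrableOn A (Icc 0 T))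
    {x : ℝ → E} {b : ℝ → ℝ} (hb : ContinuousOn b (Icc 0 T)) (hxb : ∀ s ∈ Icc 0 T, ‖x s‖ ≤ b s)
    {t : ℝ} (ht : t ∈ Icc 0 T) :
    ‖∫ s in (0 : ℝ)..t, A s (x s)‖ ≤ ∫ s in (0 : ℝ)..t, ‖A s‖ * b s := by
  have hsub : uIcc 0 t ⊆ Icc 0 T := (uIcc_of_le ht.1).trans_subset (Icc_subset_Icc_right ht.2)
  refine intervalIntegral.norm_integral_le_of_norm_le ht.1 (.of_forall fun s hs ↦ ?_)
    ((hA.mono_set hsub).intervalIntegrable.norm.mul_continuousOn (hb.mono hsub))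
  exact (A s).le_opNorm_of_le (hxb s ⟨hs.1.le, hs.2.trans ht.2⟩)

lemma integrableOn_coeFn (A : Coefficient T G) : IntegrableOn A (Icc 0 T) :=
  L1.integrable_coeFn A

lemma intervalIntegrable_coeFn_IccExtend (hT : 0 ≤ T) (A : Coefficient T (E →L[ℝ] F))
    (x : C(Icc 0 T, E)) {t : ℝ} (ht : t ∈ Icc 0 T) :
    IntervalIntegrable (fun s ↦ A s (IccExtend hT x s)) volume 0 t :=
  intervalIntegrable_clm_apply (integrableOn_coeFn A) x.continuous.Icc_extend'.continuousOn ht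

/-- The primitive `t ↦ ∫₀ᵗ A(s) x(s) ds`, as a continuous path on `[0,T]`. -/
def volterraPath (hT : 0 ≤ T) (A : Coefficient T (E →L[ℝ] F)) (x : C(Icc 0 T, E)) :
    C(Icc 0 T, F) :=
  ⟨fun t ↦ ∫ s in (0 : ℝ)..t, A s (IccExtend hT x s),
    (continuousOn_clm_integral hT (integrableOn_coeFn A)
      x.continuous.Icc_extend'.continuousOn).domRestrict⟩

lemma norm_volterraPath_apply_le (hT : 0 ≤ T) (A : Coefficient T (E →L[ℝ] F))
    (x : C(Icc 0 T, E)) {b : ℝ → ℝ} (hb : ContinuousOn b (Icc 0 T))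
    (hxb : ∀ s : Icc 0 T, ‖x s‖ ≤ b s) (t : Icc 0 T) :
    ‖volterraPath hT A x t‖ ≤ ∫ s in (0 : ℝ)..t, ‖A s‖ * b s :=
  norm_integral_clm_apply_le (integrableOn_coeFn A) hb
    (fun s hs ↦ by simpa only [IccExtend_of_mem hT _ hs] using hxb ⟨s, hs⟩) t.2

lemma integral_norm_le_norm (A : Coefficient T G) {t : ℝ} (ht : t ∈ Icc 0 T) :
    ∫ s in (0 : ℝ)..t, ‖A s‖ ≤ ‖A‖ := by
  rw [L1.norm_eq_integral_norm, intervalIntegral.integral_of_le ht.1]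
  exact setIntegral_mono_set (integrableOn_coeFn A).norm (.of_forall fun s ↦ norm_nonneg _)
    (Ioc_subset_Icc_self.trans (Icc_subset_Icc_right ht.2)).eventuallyLE

lemma norm_volterraPath_le (hT : 0 ≤ T) (A : Coefficient T (E →L[ℝ] F)) (x : C(Icc 0 T, E)) :
    ‖volterraPath hT A x‖ ≤ 1 * ‖A‖ * ‖x‖ := by
  refine (ContinuousMap.norm_le _ (by positivity)).2 fun t ↦ ?_
  calc ‖volterraPath hT A x t‖
      ≤ ∫ s in (0 : ℝ)..t, ‖A s‖ * ‖x‖ :=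
        norm_volterraPath_apply_le hT A x continuousOn_const (fun s ↦ x.norm_coe_le_norm s) t
    _ = (∫ s in (0 : ℝ)..t, ‖A s‖) * ‖x‖ := intervalIntegral.integral_mul_const _ _
    _ ≤ 1 * ‖A‖ * ‖x‖ := by
        rw [one_mul]
        gcongr
        exact integral_norm_le_norm A t.2

/-- The Volterra operator `(A, x) ↦ (t ↦ ∫₀ᵗ A(s) x(s) ds)` on `[0,T]`, as a continuous bilinear
map of the integrable coefficient `A` and of the continuous path `x`. -/
def volterra (hT : 0 ≤ T) :
    Coefficient T (E →L[ℝ] F) →L[ℝ] C(Icc 0 T, E) →L[ℝ] C(Icc 0 T, F) :=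
  LinearMap.mkContinuous₂ (LinearMap.mk₂ ℝ (volterraPath hT)
    (fun A B x ↦ ContinuousMap.ext fun t ↦
      (intervalIntegral_congr_ae_restrict_Icc ((Lp.coeFn_add A B).mono fun s hs ↦
        congrArg (· (IccExtend hT x s)) hs) t.2).trans <|
      intervalIntegral.integral_add (intervalIntegrable_coeFn_IccExtend hT A x t.2)
        (intervalIntegrable_coeFn_IccExtend hT B x t.2))
    (fun c A x ↦ ContinuousMap.ext fun t ↦
      (intervalIntegral_congr_ae_restrict_Icc ((Lp.coeFn_smul c A).mono fun s hs ↦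
        congrArg (· (IccExtend hT x s)) hs) t.2).trans <|
      intervalIntegral.integral_smul c _)
    (fun A x y ↦ ContinuousMap.ext fun t ↦
      (intervalIntegral.integral_congr fun s _ ↦
        (A s).map_add (IccExtend hT x s) (IccExtend hT y s)).trans <|
      intervalIntegral.integral_add (intervalIntegrable_coeFn_IccExtend hT A x t.2)
        (intervalIntegrable_coeFn_IccExtend hT A y t.2))
    (fun c A x ↦ ContinuousMap.ext fun _ ↦
      (intervalIntegral.integral_congr fun s _ ↦ (A s).map_smul c (IccExtend hT x s)).trans <|
      intervalIntegral.integral_smul c _))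
    1 (norm_volterraPath_le hT)

lemma volterra_apply (hT : 0 ≤ T) (A : Coefficient T (E →L[ℝ] F)) (x : C(Icc 0 T, E))
    (t : Icc 0 T) : volterra hT A x t = ∫ s in (0 : ℝ)..t, A s (IccExtend hT x s) :=
  rfl

lemma norm_volterra_pow_apply_le (hT : 0 ≤ T) (A : Coefficient T (E →L[ℝ] E))
    (x : C(Icc 0 T, E)) (k : ℕ) (t : Icc 0 T) :
    ‖(volterra hT A ^ k) x t‖ ≤ ‖x‖ * ((∫ s in (0 : ℝ)..t, ‖A s‖) ^ k / k.factorial) := by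
  induction k generalizing t with
  | zero => simpa using x.norm_coe_le_norm t
  | succ k ih =>
    have hint : IntervalIntegrable (fun s ↦ ‖A s‖) volume 0 T :=
      ((integrableOn_coeFn A).mono_set (uIcc_of_le hT).subset).intervalIntegrable.norm
    have hcont : ContinuousOn (fun t ↦ ‖x‖ * ((∫ s in (0 : ℝ)..t, ‖A s‖) ^ k / k.factorial))
        (Icc 0 T) := by
      have hprimitive := intervalIntegral.continuousOn_primitive_interval' hint left_mem_uIcc
      rw [uIcc_of_le hT] at hprimitive
      exact continuousOn_const.mul ((hprimitive.pow k).div_const _)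
    calc ‖(volterra hT A ^ (k + 1)) x t‖
        = ‖volterraPath hT A ((volterra hT A ^ k) x) t‖ := by rw [pow_succ']; rfl
      _ ≤ ∫ s in (0 : ℝ)..t, ‖A s‖ * (‖x‖ * ((∫ r in (0 : ℝ)..s, ‖A r‖) ^ k / k.factorial)) :=
          norm_volterraPath_apply_le hT A _ hcont ih t
      _ = ‖x‖ / k.factorial * ∫ s in (0 : ℝ)..t, ‖A s‖ * (∫ r in (0 : ℝ)..s, ‖A r‖) ^ k := by
          rw [← intervalIntegral.integral_const_mul]
          congr 1 with s
          ring
      _ = ‖x‖ * ((∫ s in (0 : ℝ)..t, ‖A s‖) ^ (k + 1) / (k + 1).factorial) := by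
          rw [integral_mul_integral_pow (hint.mono_set (uIcc_subset_uIcc_left
            ((uIcc_of_le hT).symm ▸ t.2))), Nat.factorial_succ]
          push_cast
          field_simp

lemma isUnit_one_sub_of_norm_pow_lt_one {R : Type*} [NormedRing R] [CompleteSpace R] {a : R}
    {k : ℕ} (h : ‖a ^ k‖ < 1) : IsUnit (1 - a) := by
  have hcomm : Commute (1 - a) (∑ i ∈ Finset.range k, a ^ i) := by
    rw [Commute, SemiconjBy, mul_neg_geom_sum, geom_sum_mul_neg]
  refine (hcomm.isUnit_mul_iff.1 ?_).1
  rw [mul_neg_geom_sum]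
  exact isUnit_one_sub_of_norm_lt_one h

lemma isUnit_one_sub_volterra [CompleteSpace E] (hT : 0 ≤ T) (A : Coefficient T (E →L[ℝ] E)) :
    IsUnit (1 - volterra hT A) := by
  obtain ⟨k, hk⟩ :=
    ((FloorSemiring.tendsto_pow_div_factorial_atTop ‖A‖).eventually_lt_const one_pos).exists
  have hnorm : ‖volterra hT A ^ k‖ ≤ ‖A‖ ^ k / k.factorial := by
    refine ContinuousLinearMap.opNorm_le_bound _ (by positivity) fun x ↦
      (ContinuousMap.norm_le _ (by positivity)).2 fun t ↦
      (norm_volterra_pow_apply_le hT A x k t).trans ?_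
    rw [mul_comm]
    gcongr
    · exact intervalIntegral.integral_nonneg t.2.1 fun s _ ↦ norm_nonneg _
    · exact integral_norm_le_norm A t.2
  exact isUnit_one_sub_of_norm_pow_lt_one (R := C(Icc 0 T, E) →L[ℝ] C(Icc 0 T, E))
    (hnorm.trans_lt hk)

end Volterra

section LinearEquation

variable [CompleteSpace E] {x₀ : E}

/-- The solution on `[0,T]` of the linear Carathéodory equation `x' = A(t) x`, `x(0) = x₀`,
obtained by inverting the Volterra operator. -/
def linearSolution (hT : 0 ≤ T) (x₀ : E) (A : Coefficient T (E →L[ℝ] E)) : C(Icc 0 T, E) :=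
  Ring.inverse (1 - volterra hT A) (ContinuousMap.const _ x₀)

lemma isCaratheodorySolution_linearSolution (hT : 0 ≤ T) (x₀ : E)
    (A : Coefficient T (E →L[ℝ] E)) :
    IsCaratheodorySolution T (fun s ↦ A s) x₀ (IccExtend hT (linearSolution hT x₀ A)) := by
  have hfix : linearSolution hT x₀ A - volterra hT A (linearSolution hT x₀ A) =
      ContinuousMap.const _ x₀ :=
    DFunLike.congr_fun (Ring.mul_inverse_cancel _ (isUnit_one_sub_volterra hT A)) _
  refine ⟨(linearSolution hT x₀ A).continuous.Icc_extend'.continuousOn, fun t ht ↦ ?_⟩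
  rw [IccExtend_of_mem hT _ ht]
  exact sub_eq_iff_eq_add.1 (DFunLike.congr_fun hfix ⟨t, ht⟩)

lemma IsCaratheodorySolution.eq_linearSolution (hT : 0 ≤ T) {A : Coefficient T (E →L[ℝ] E)}
    {x : ℝ → E} (hx : IsCaratheodorySolution T (fun s ↦ A s) x₀ x) (t : Icc 0 T) :
    x t = linearSolution hT x₀ A t := by
  let y : C(Icc 0 T, E) := ⟨fun t ↦ x t, hx.1.domRestrict⟩
  have hfix : (1 - volterra hT A) y = ContinuousMap.const _ x₀ := by
    ext t
    change x t - volterra hT A y t = x₀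
    rw [volterra_apply, sub_eq_iff_eq_add, hx.2 t t.2]
    congr 1
    refine intervalIntegral.integral_congr fun s hs ↦ ?_
    rw [uIcc_of_le t.2.1] at hs
    exact congrArg (A s) (IccExtend_of_mem hT y ⟨hs.1, hs.2.trans t.2.2⟩).symm
  have hy : linearSolution hT x₀ A = y := by
    rw [linearSolution, ← hfix]
    exact DFunLike.congr_fun (Ring.inverse_mul_cancel _ (isUnit_one_sub_volterra hT A)) y
  exact (DFunLike.congr_fun hy t).symm

lemma exists_isCaratheodorySolution_clm (hT : 0 ≤ T) {A : ℝ → E →L[ℝ] E}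
    (hA : IntegrableOn A (Icc 0 T)) (x₀ : E) :
    ∃ x, IsCaratheodorySolution T (fun s ↦ A s) x₀ x :=
  ⟨_, (isCaratheodorySolution_linearSolution hT x₀ hA.toL1).congr_ae
    (hA.coeFn_toL1.mono fun _ hs ↦ congrArg _ hs)⟩

lemma differentiableAt_inverse_one_sub_clm_apply (V : F →L[ℝ] E →L[ℝ] E) (c : E) {v : F}
    (hv : IsUnit (1 - V v)) : DifferentiableAt ℝ (fun w ↦ Ring.inverse (1 - V w) c) v := by
  have hinv : DifferentiableAt ℝ (fun w ↦ Ring.inverse (1 - V w)) v :=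
    DifferentiableAt.comp (g := Ring.inverse) v (differentiableAt_inverse (𝕜 := ℝ) hv)
      (V.differentiableAt.const_sub _)
  exact hinv.clm_apply (differentiableAt_const c)

lemma differentiable_linearSolution (hT : 0 ≤ T) (x₀ : E) :
    Differentiable ℝ (linearSolution hT x₀) := by
  intro A
  unfold linearSolution
  exact differentiableAt_inverse_one_sub_clm_apply (F := Coefficient T (E →L[ℝ] E))
    (E := C(Icc 0 T, E)) (volterra hT) _ (isUnit_one_sub_volterra hT A)

end LinearEquation

/-- The affine map sending a control `u` to the integrable coefficient `t ↦ a + u(t) b`. -/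
def controlCoefficient (T : ℝ) (a b : F) (u : Control T) : Coefficient T F :=
  Lp.const 1 _ a +
    (ContinuousLinearMap.lsmul ℝ ℝ).holderL (volume.restrict (Icc 0 T)) 2 2 1 u (Lp.const 2 _ b)

lemma coeFn_controlCoefficient (a b : F) (u : Control T) :
    controlCoefficient T a b u =ᵐ[volume.restrict (Icc 0 T)] fun s ↦ a + (u s : ℝ) • b := by
  filter_upwards [Lp.coeFn_add (Lp.const 1 (volume.restrict (Icc 0 T)) a) _,
    Lp.coeFn_const (p := 1) (μ := volume.restrict (Icc 0 T)) a,
    Lp.coeFn_const (p := 2) (μ := volume.restrict (Icc 0 T)) b,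
    (ContinuousLinearMap.lsmul ℝ ℝ).coeFn_holder (r := 1) u
      (Lp.const 2 (volume.restrict (Icc 0 T)) b)] with s hadd ha hb hmul
  refine hadd.trans ?_
  rw [Pi.add_apply]
  exact congrArg₂ (· + ·) ha (hmul.trans (congrArg ((u s : ℝ) • ·) hb))

lemma integrableOn_add_control_smul (a b : F) (u : Control T) :
    IntegrableOn (fun s ↦ a + (u s : ℝ) • b) (Icc 0 T) :=
  (integrableOn_coeFn (controlCoefficient T a b u)).congr (coeFn_controlCoefficient a b u)

lemma differentiable_controlCoefficient (a b : F) :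
    Differentiable ℝ (controlCoefficient T a b) := by
  let mulConst := ((ContinuousLinearMap.lsmul ℝ ℝ).holderL (volume.restrict (Icc 0 T)) 2 2
    1).flip (Lp.const 2 _ b)
  exact Differentiable.const_add _ mulConst.differentiable

end Caratheodory

section CommutatorEquation

variable {𝔸 : Type*} [NormedRing 𝔸] [NormedAlgebra ℝ 𝔸]

/-- The commutator of a normed algebra, as a continuous bilinear map. -/
def lieCLM (𝔸 : Type*) [NormedRing 𝔸] [NormedAlgebra ℝ 𝔸] : 𝔸 →L[ℝ] 𝔸 →L[ℝ] 𝔸 :=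
  ContinuousLinearMap.mul ℝ 𝔸 - (ContinuousLinearMap.mul ℝ 𝔸).flip

variable [StarRing 𝔸] [NormedStarGroup 𝔸] [StarModule ℝ 𝔸] [CompleteSpace 𝔸] {T : ℝ}
  {H y : ℝ → 𝔸} {y₀ : 𝔸}

/-- In the moving frame of the propagator `U` the solutions of `y' = [H, y]` are constant. -/
lemma star_propagator_mul_mul_propagator (hT : 0 ≤ T) (hH : ∀ s, H s ∈ skewAdjoint 𝔸)
    (hint : IntegrableOn H (Icc 0 T)) {U : ℝ → 𝔸}
    (hU : IsCaratheodorySolution T (fun s X ↦ H s * X) 1 U)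
    (hy : IsCaratheodorySolution T (fun s X ↦ ⁅H s, X⁆) y₀ y) {t : ℝ} (ht : t ∈ Icc 0 T) :
    star (U t) * y t * U t = y₀ := by
  have hHU : IntegrableOn (fun s ↦ H s * U s) (Icc 0 T) :=
    integrableOn_clm_apply ((ContinuousLinearMap.mul ℝ 𝔸).integrable_comp hint) hU.1
  have hHy : IntegrableOn (fun s ↦ ⁅H s, y s⁆) (Icc 0 T) :=
    integrableOn_clm_apply ((lieCLM 𝔸).integrable_comp hint) hy.1
  have hU_ac := hU.absolutelyContinuousOnInterval hT hHU
  have hy_ac := hy.absolutelyContinuousOnInterval hT hHy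
  have hac : AbsolutelyContinuousOnInterval (fun t ↦ star (U t) * y t * U t) 0 T :=
    absolutelyContinuousOnInterval_bilin (ContinuousLinearMap.mul ℝ 𝔸)
      (absolutelyContinuousOnInterval_bilin (ContinuousLinearMap.mul ℝ 𝔸)
        (absolutelyContinuousOnInterval_star hU_ac) hy_ac) hU_ac
  have hderiv : ∀ᵐ t, t ∈ uIcc 0 T → HasDerivAt (fun t ↦ star (U t) * y t * U t) 0 t := by
    filter_upwards [hU.ae_hasDerivAt hT hHU, hy.ae_hasDerivAt hT hHy] with t hUt hyt ht
    rw [uIcc_of_le hT] at ht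
    refine (((hUt ht).star.fun_mul (hyt ht)).fun_mul (hUt ht)).congr_deriv ?_
    rw [star_mul, skewAdjoint.mem_iff.1 (hH t), Ring.lie_def]
    noncomm_ring
  obtain ⟨C, hC⟩ := hac.const_of_ae_hasDerivAt_zero hderiv
  rw [uIcc_of_le hT] at hC
  rw [hC t ht, ← hC 0 (left_mem_Icc.2 hT), hU.apply_zero hT, hy.apply_zero hT, star_one, one_mul,
    mul_one]

lemma exists_star_mul_self_eq_one_of_commutatorEquation (hT : 0 ≤ T)
    (hH : ∀ s, H s ∈ skewAdjoint 𝔸) (hint : IntegrableOn H (Icc 0 T))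
    (hy : IsCaratheodorySolution T (fun s X ↦ ⁅H s, X⁆) y₀ y) {t : ℝ} (ht : t ∈ Icc 0 T) :
    ∃ U : 𝔸, star U * U = 1 ∧ star U * y t * U = y₀ := by
  obtain ⟨U, hU⟩ := exists_isCaratheodorySolution_clm hT
    ((ContinuousLinearMap.mul ℝ 𝔸).integrable_comp hint) 1
  have hone : IsCaratheodorySolution T (fun s X ↦ ⁅H s, X⁆) 1 fun _ ↦ (1 : 𝔸) :=
    ⟨continuousOn_const, fun t _ ↦ by simp [Ring.lie_def]⟩
  refine ⟨U t, ?_, star_propagator_mul_mul_propagator hT hH hint hU hy ht⟩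
  simpa only [mul_one] using star_propagator_mul_mul_propagator hT hH hint hU hone ht

end CommutatorEquation

section EndPoint

variable {n : ℕ} {T : ℝ} {H₀ H₁ ρ₀ : Mat n}

lemma isTrajectory_iff (u : Control T) (ρ : ℝ → Mat n) :
    IsTrajectory T H₀ H₁ ρ₀ u ρ ↔
      IsCaratheodorySolution T (fun s ↦ controlCoefficient T (lieCLM (Mat n) H₀)
        (lieCLM (Mat n) H₁) u s) ρ₀ ρ := by
  have hcoeff : (fun s ↦ ⇑(controlCoefficient T (lieCLM (Mat n) H₀) (lieCLM (Mat n) H₁) u s))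
      =ᵐ[volume.restrict (Icc 0 T)] fun s X ↦ ⁅H₀ + (u s : ℝ) • H₁, X⁆ := by
    filter_upwards [coeFn_controlCoefficient (lieCLM (Mat n) H₀) (lieCLM (Mat n) H₁) u] with s hs
    rw [hs, ← map_smul, ← map_add]
    rfl
  exact ⟨fun h ↦ IsCaratheodorySolution.congr_ae h hcoeff.symm, fun h ↦ h.congr_ae hcoeff⟩

lemma isTrajectory_trajectory (hT : 0 ≤ T) (u : Control T) :
    IsTrajectory T H₀ H₁ ρ₀ u (trajectory T H₀ H₁ ρ₀ u) :=
  Classical.epsilon_spec ⟨_, (isTrajectory_iff u _).2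
    (isCaratheodorySolution_linearSolution hT ρ₀ _)⟩

lemma endPoint_eq_linearSolution (hT : 0 ≤ T) (u : Control T) :
    endPoint T H₀ H₁ ρ₀ u = linearSolution hT ρ₀
      (controlCoefficient T (lieCLM (Mat n) H₀) (lieCLM (Mat n) H₁) u) ⟨T, hT, le_rfl⟩ :=
  ((isTrajectory_iff u _).1 (isTrajectory_trajectory hT u)).eq_linearSolution hT ⟨T, hT, le_rfl⟩

lemma differentiable_endPoint (hT : 0 ≤ T) : Differentiable ℝ (endPoint T H₀ H₁ ρ₀) := by
  rw [funext (endPoint_eq_linearSolution hT)]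
  exact (ContinuousMap.evalCLM (M := Mat n) ℝ (⟨T, hT, le_rfl⟩ : Icc 0 T)).differentiable.comp
    ((differentiable_linearSolution hT ρ₀).comp (differentiable_controlCoefficient _ _))

lemma exists_unitary_endPoint_eq (hT : 0 ≤ T) (hH₀ : H₀ ∈ skewAdjoint (Mat n))
    (hH₁ : H₁ ∈ skewAdjoint (Mat n)) (u : Control T) :
    ∃ U ∈ Matrix.unitaryGroup (Fin n) ℂ, endPoint T H₀ H₁ ρ₀ u = U * ρ₀ * star U := by
  obtain ⟨U, hU, hUy⟩ := exists_star_mul_self_eq_one_of_commutatorEquation hT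
    (fun s ↦ add_mem hH₀ (skewAdjoint.smul_mem (u s : ℝ) hH₁))
    (integrableOn_add_control_smul H₀ H₁ u)
    (isTrajectory_trajectory hT u) ⟨hT, le_rfl⟩
  have hU' : U * star U = 1 := mul_eq_one_comm.1 hU
  refine ⟨U, Matrix.mem_unitaryGroup_iff.2 hU', ?_⟩
  calc endPoint T H₀ H₁ ρ₀ u
      = U * star U * endPoint T H₀ H₁ ρ₀ u * (U * star U) := by rw [hU', one_mul, mul_one]
    _ = U * (star U * endPoint T H₀ H₁ ρ₀ u * U) * star U := by simp only [mul_assoc]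
    _ = U * ρ₀ * star U := by rw [endPoint, hUy]

end EndPoint

section Velocity

variable {𝔸 : Type*} [NormedRing 𝔸] [NormedAlgebra ℝ 𝔸]

lemma hasDerivAt_exp_smul_mul_mul_exp_neg_smul [CompleteSpace 𝔸] (A ρ : 𝔸) :
    HasDerivAt (fun s : ℝ ↦ NormedSpace.exp (s • A) * ρ * NormedSpace.exp (-(s • A))) ⁅A, ρ⁆ 0 := by
  have h := ((hasDerivAt_exp_smul_const (𝕂 := ℝ) A 0).mul_const ρ).fun_mul
    (hasDerivAt_exp_smul_const (𝕂 := ℝ) (-A) 0)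
  simp only [smul_neg] at h
  refine h.congr_deriv ?_
  simp [Ring.lie_def, sub_eq_add_neg]

/-- The unitaries `U s` with `γ s = U s * ρ * star (U s)` need not depend continuously on `s`.
However `(γ s - ρ) * U s = ⁅U s, ρ⁆`, so that `η * V` is a commutator with `ρ` for every cluster
point `V` of `U s` as `s → 0`, and `V` commutes with `ρ`. -/
lemma exists_lie_eq_of_hasDerivAt_unitary_conj [FiniteDimensional ℝ 𝔸] [StarRing 𝔸]
    (hK : IsCompact (unitary 𝔸 : Set 𝔸)) {γ : ℝ → 𝔸} {ρ η : 𝔸}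
    (hγ : ∀ s, ∃ U ∈ unitary 𝔸, γ s = U * ρ * star U) (hγ₀ : γ 0 = ρ) (hη : HasDerivAt γ η 0) :
    ∃ X : 𝔸, ⁅X, ρ⁆ = η := by
  choose U hU hγU using hγ
  have hmul (s : ℝ) : γ s * U s = U s * ρ := by
    rw [hγU, mul_assoc _ _ (U s), Unitary.star_mul_self_of_mem (hU s), mul_one]
  obtain ⟨V, hV, hlim⟩ : ∃ V ∈ unitary 𝔸, MapClusterPt V (𝓝[≠] (0 : ℝ)) U :=
    hK.exists_mapClusterPt (tendsto_principal.2 (Eventually.of_forall hU))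
  obtain ⟨l, hl, hUV⟩ := mapClusterPt_iff_ultrafilter.1 hlim
  have hcomm : ρ * V = V * ρ := by
    have hγl : Tendsto γ l (𝓝 ρ) := by
      simpa only [hγ₀] using hη.continuousAt.tendsto.mono_left (hl.trans nhdsWithin_le_nhds)
    refine tendsto_nhds_unique (hγl.mul hUV) ?_
    simpa only [hmul] using hUV.mul_const ρ
  obtain ⟨X, hX⟩ : η * V ∈ ((lieCLM 𝔸).flip ρ).range := by
    refine (Submodule.closed_of_finiteDimensional _).mem_of_tendsto
      ((hη.tendsto_slope.mono_left hl).mul hUV) (Eventually.of_forall fun s ↦ ⟨s⁻¹ • U s, ?_⟩)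
    change ⁅s⁻¹ • U s, ρ⁆ = slope γ 0 s * U s
    rw [slope_def_module, sub_zero, hγ₀, smul_mul_assoc, sub_mul, hmul, Ring.lie_def,
      smul_mul_assoc, mul_smul_comm, smul_sub]
  have hstar : star V * ρ = ρ * star V := by
    calc star V * ρ = star V * (ρ * V) * star V := by
          rw [mul_assoc, mul_assoc, Unitary.mul_star_self_of_mem hV, mul_one]
      _ = ρ * star V := by
          rw [hcomm, ← mul_assoc, Unitary.star_mul_self_of_mem hV, one_mul]
  refine ⟨X * star V, ?_⟩
  calc ⁅X * star V, ρ⁆ = ⁅X, ρ⁆ * star V := by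
        rw [Ring.lie_def, Ring.lie_def, sub_mul, mul_assoc, hstar]; simp only [mul_assoc]
    _ = η * V * star V := congrArg (· * star V) hX
    _ = η := by rw [mul_assoc, Unitary.mul_star_self_of_mem hV, mul_one]

end Velocity

section Orbit

variable {n : ℕ} {ρ₀ ρ : Mat n}

lemma isCompact_unitaryGroup (m 𝕜 : Type*) [Fintype m] [DecidableEq m] [RCLike 𝕜] :
    IsCompact (Matrix.unitaryGroup m 𝕜 : Set (Matrix m m 𝕜)) := by
  have hbox : IsCompact (univ.pi fun _ : m ↦ univ.pi fun _ : m ↦ Metric.closedBall (0 : 𝕜) 1) :=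
    isCompact_univ_pi fun _ ↦ isCompact_univ_pi fun _ ↦ isCompact_closedBall 0 1
  exact IsCompact.of_isClosed_subset (X := Matrix m m 𝕜) hbox isClosed_unitary
    fun U hU i _ j _ ↦ mem_closedBall_zero_iff.2 (entry_norm_bound_of_unitary hU i j)

lemma exists_smul_mem_specialUnitaryGroup {m : Type*} [Fintype m] [DecidableEq m] [Nonempty m]
    {U : Matrix m m ℂ} (hU : U ∈ Matrix.unitaryGroup m ℂ) :
    ∃ c ∈ unitary ℂ, c • U ∈ Matrix.specialUnitaryGroup m ℂ := by
  have hdet : U.det ∈ unitary ℂ := Matrix.det_of_mem_unitary hU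
  have hdet_norm : ‖U.det‖ = 1 := CStarRing.norm_of_mem_unitary hdet
  obtain ⟨c, hc⟩ := IsAlgClosed.exists_pow_nat_eq U.det⁻¹ (Fintype.card_pos (α := m))
  have hc_norm : ‖c‖ = 1 := by
    rw [← pow_eq_one_iff_of_nonneg (norm_nonneg c) (Fintype.card_ne_zero (α := m)),
      ← norm_pow, hc, norm_inv, hdet_norm, inv_one]
  have hc_star : star c * c = 1 := by
    rw [Complex.star_def, Complex.conj_mul', hc_norm, Complex.ofReal_one, one_pow]
  refine ⟨c, Unitary.mem_iff.2 ⟨hc_star, mul_comm c _ ▸ hc_star⟩,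
    Matrix.mem_specialUnitaryGroup_iff.2 ⟨Matrix.mem_unitaryGroup_iff'.2 ?_, ?_⟩⟩
  · rw [star_smul, smul_mul_smul_comm, hc_star, Unitary.star_mul_self_of_mem hU, one_smul]
  · rw [Matrix.det_smul, hc,
      inv_mul_cancel₀ (norm_ne_zero_iff.1 (hdet_norm.trans_ne one_ne_zero))]

lemma mem_orbit_iff :
    ρ ∈ orbit ρ₀ ↔ ∃ U ∈ Matrix.unitaryGroup (Fin n) ℂ, ρ = U * ρ₀ * star U := by
  refine ⟨fun ⟨U, hU, h⟩ ↦ ⟨U, (Matrix.mem_specialUnitaryGroup_iff.1 hU).1, h⟩, ?_⟩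
  rintro ⟨U, hU, rfl⟩
  rcases isEmpty_or_nonempty (Fin n) with _ | _
  · exact ⟨1, one_mem _, Subsingleton.elim _ _⟩
  obtain ⟨c, hc, hcU⟩ := exists_smul_mem_specialUnitaryGroup hU
  refine ⟨c • U, hcU, ?_⟩
  rw [← Matrix.star_eq_conjTranspose, star_smul, smul_mul_assoc, smul_mul_smul_comm,
    Unitary.mul_star_self_of_mem hc, one_smul]

lemma endPoint_mem_orbit {T : ℝ} {H₀ H₁ : Mat n} (hT : 0 ≤ T) (hH₀ : H₀ ∈ skewAdjoint (Mat n))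
    (hH₁ : H₁ ∈ skewAdjoint (Mat n)) (u : Control T) : endPoint T H₀ H₁ ρ₀ u ∈ orbit ρ₀ :=
  mem_orbit_iff.2 (exists_unitary_endPoint_eq hT hH₀ hH₁ u)

lemma conj_mem_orbit {U : Mat n} (hU : U ∈ Matrix.unitaryGroup (Fin n) ℂ) (hρ : ρ ∈ orbit ρ₀) :
    U * ρ * star U ∈ orbit ρ₀ := by
  obtain ⟨V, hV, rfl⟩ := mem_orbit_iff.1 hρ
  exact mem_orbit_iff.2 ⟨U * V, mul_mem hU hV, by rw [star_mul]; simp only [mul_assoc]⟩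

lemma mem_orbit_symm (hρ : ρ ∈ orbit ρ₀) : ρ₀ ∈ orbit ρ := by
  obtain ⟨U, hU, rfl⟩ := mem_orbit_iff.1 hρ
  refine mem_orbit_iff.2 ⟨star U, Unitary.star_mem hU, ?_⟩
  simpa using ((Unitary.conjStarAlgAut ℂ (Mat n) ⟨U, hU⟩).symm_apply_apply ρ₀).symm

lemma orbit_eq_of_mem (hρ : ρ ∈ orbit ρ₀) : orbit ρ = orbit ρ₀ := by
  have orbit_subset {σ τ : Mat n} (h : σ ∈ orbit τ) : orbit σ ⊆ orbit τ := by
    intro _ h'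
    obtain ⟨U, hU, rfl⟩ := mem_orbit_iff.1 h'
    exact conj_mem_orbit hU h
  exact (orbit_subset hρ).antisymm (orbit_subset (mem_orbit_symm hρ))

lemma isHermitian_of_mem_orbit (hρ₀ : ρ₀.IsHermitian) (hρ : ρ ∈ orbit ρ₀) : ρ.IsHermitian := by
  obtain ⟨U, -, rfl⟩ := hρ
  exact Matrix.isHermitian_mul_mul_conjTranspose U hρ₀

lemma lie_mem_tangentSpace (hρ : ρ ∈ orbit ρ₀) {A : Mat n} (hA : A ∈ skewAdjoint (Mat n)) :
    ⁅A, ρ⁆ ∈ tangentSpace ρ₀ ρ := by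
  refine Submodule.subset_span
    ⟨_, fun s ↦ ?_, by simp, hasDerivAt_exp_smul_mul_mul_exp_neg_smul A ρ⟩
  have hsA : s • A ∈ skewAdjoint (Mat n) := skewAdjoint.smul_mem s hA
  have := conj_mem_orbit (NormedSpace.exp_mem_unitary_of_mem_skewAdjoint hsA) hρ
  rwa [NormedSpace.star_exp, skewAdjoint.mem_iff.1 hsA] at this

lemma exists_lie_eq_of_mem_tangentSpace {η : Mat n} (hη : η ∈ tangentSpace ρ₀ ρ) :
    ∃ X : Mat n, ⁅X, ρ⁆ = η := by
  suffices h : tangentSpace ρ₀ ρ ≤ ((lieCLM (Mat n)).flip ρ).range from h hη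
  refine Submodule.span_le.2 ?_
  rintro η ⟨γ, hγ, hγ₀, hη⟩
  have hρ : ρ ∈ orbit ρ₀ := hγ₀ ▸ hγ 0
  refine exists_lie_eq_of_hasDerivAt_unitary_conj (isCompact_unitaryGroup (Fin n) ℂ)
    (fun s ↦ mem_orbit_iff.1 ?_) hγ₀ hη
  rw [orbit_eq_of_mem hρ]
  exact hγ s

lemma map_conj_tangentSpace_le (U : unitary (Mat n)) :
    (tangentSpace ρ₀ ρ).map (Unitary.conjStarAlgAut ℝ (Mat n) U).toAlgEquiv.toLinearMap ≤
      tangentSpace ρ₀ (U * ρ * star (U : Mat n)) := by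
  rw [tangentSpace, Submodule.map_span, Submodule.span_le]
  rintro _ ⟨η, ⟨γ, hγ, rfl, hη⟩, rfl⟩
  exact Submodule.subset_span ⟨fun s ↦ U * γ s * star (U : Mat n),
    fun s ↦ conj_mem_orbit U.2 (hγ s), rfl, (hη.const_mul _).mul_const _⟩

lemma finrank_tangentSpace_le (hρ : ρ ∈ orbit ρ₀) :
    Module.finrank ℝ (tangentSpace ρ₀ ρ) ≤ orbitDim ρ₀ := by
  obtain ⟨U, hU, h⟩ := mem_orbit_iff.1 (mem_orbit_symm hρ)
  have hmap := map_conj_tangentSpace_le (ρ₀ := ρ₀) (ρ := ρ) ⟨U, hU⟩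
  rw [← h] at hmap
  calc Module.finrank ℝ (tangentSpace ρ₀ ρ)
      = Module.finrank ℝ ((tangentSpace ρ₀ ρ).map
          (Unitary.conjStarAlgAut ℝ (Mat n) ⟨U, hU⟩).toAlgEquiv.toLinearMap) :=
        (LinearEquiv.finrank_map_eq
          (Unitary.conjStarAlgAut ℝ (Mat n) ⟨U, hU⟩).toAlgEquiv.toLinearEquiv _).symm
    _ ≤ orbitDim ρ₀ := Submodule.finrank_mono hmap

end Orbit

section Cost

variable {n : ℕ} {ρ₀ ρ θ : Mat n}

/-- The cost function `J` bundled as a continuous linear form: it is its own derivative. -/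
def costCLM (θ : Mat n) : Mat n →L[ℝ] ℝ :=
  LinearMap.toContinuousLinearMap
    { toFun := cost θ
      map_add' := fun x y ↦ by simp [cost, add_mul]
      map_smul' := fun c x ↦ by simp [cost] }

lemma hasFDerivAt_cost (θ ρ : Mat n) : HasFDerivAt (cost θ) (costCLM θ) ρ :=
  (costCLM θ).hasFDerivAt

lemma isCriticalState_iff (hρ : ρ ∈ orbit ρ₀) :
    IsCriticalState ρ₀ θ ρ ↔ ∀ η ∈ tangentSpace ρ₀ ρ, cost θ η = 0 := by
  simp only [IsCriticalState, hρ, true_and, (hasFDerivAt_cost θ ρ).fderiv]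
  rfl

lemma trace_lie_mul {m R : Type*} [Fintype m] [CommRing R] (A B C : Matrix m m R) :
    (⁅A, B⁆ * C).trace = (A * ⁅B, C⁆).trace := by
  rw [Ring.lie_def, Ring.lie_def, sub_mul, mul_sub, Matrix.trace_sub, Matrix.trace_sub,
    mul_assoc A, mul_assoc B, Matrix.trace_mul_comm B, mul_assoc A]

lemma cost_lie (θ A ρ : Mat n) : cost θ ⁅A, ρ⁆ = (A * ⁅ρ, θ⁆).trace.re :=
  congrArg Complex.re (trace_lie_mul A ρ θ)

open ComplexOrder in
lemma eq_zero_of_re_trace_mul_self_eq_zero {m 𝕜 : Type*} [Fintype m] [RCLike 𝕜]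
    {A : Matrix m m 𝕜} (hA : A ∈ skewAdjoint (Matrix m m 𝕜)) (h : RCLike.re (A * A).trace = 0) :
    A = 0 := by
  rw [← Matrix.trace_conjTranspose_mul_self_eq_zero_iff]
  have hnonneg := (Matrix.posSemidef_conjTranspose_mul_self A).trace_nonneg
  refine RCLike.ext ?_ ?_
  · rw [← Matrix.star_eq_conjTranspose, skewAdjoint.mem_iff.1 hA, neg_mul, Matrix.trace_neg,
      map_neg, h, neg_zero, map_zero]
  · rw [(RCLike.nonneg_iff.1 hnonneg).2, map_zero]

lemma isCriticalState_iff_lie_eq_zero (hρ₀ : ρ₀.IsHermitian) (hθ : θ.IsHermitian)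
    (hρ : ρ ∈ orbit ρ₀) : IsCriticalState ρ₀ θ ρ ↔ ⁅ρ, θ⁆ = 0 := by
  rw [isCriticalState_iff hρ]
  constructor
  · intro hcrit
    have hskew : ⁅ρ, θ⁆ ∈ skewAdjoint (Mat n) := by
      rw [skewAdjoint.mem_iff, Matrix.star_eq_conjTranspose, Ring.lie_def,
        Matrix.conjTranspose_sub, Matrix.conjTranspose_mul, Matrix.conjTranspose_mul,
        (isHermitian_of_mem_orbit hρ₀ hρ).eq, hθ.eq, neg_sub]
    refine eq_zero_of_re_trace_mul_self_eq_zero hskew ?_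
    exact (cost_lie θ _ ρ).symm.trans (hcrit _ (lie_mem_tangentSpace hρ hskew))
  · intro hlie η hη
    obtain ⟨X, rfl⟩ := exists_lie_eq_of_mem_tangentSpace hη
    rw [cost_lie, hlie, mul_zero, Matrix.trace_zero, Complex.zero_re]

end Cost

section RegularControl

variable {n : ℕ} {T : ℝ} {H₀ H₁ ρ₀ : Mat n}

lemma range_fderiv_endPoint_le (hT : 0 ≤ T) (hH₀ : H₀ ∈ skewAdjoint (Mat n))
    (hH₁ : H₁ ∈ skewAdjoint (Mat n)) (u : Control T) :
    (fderiv ℝ (endPoint T H₀ H₁ ρ₀) u).toLinearMap.range ≤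
      tangentSpace ρ₀ (endPoint T H₀ H₁ ρ₀ u) := by
  rintro _ ⟨v, rfl⟩
  refine Submodule.subset_span ⟨fun s ↦ endPoint T H₀ H₁ ρ₀ (u + s • v),
    fun s ↦ endPoint_mem_orbit hT hH₀ hH₁ _, by simp, ?_⟩
  exact (differentiable_endPoint hT u).hasFDerivAt.hasLineDerivAt v

lemma IsRegular.range_fderiv_endPoint_eq {u : Control T} (hu : IsRegular T H₀ H₁ ρ₀ u)
    (hT : 0 ≤ T) (hH₀ : H₀ ∈ skewAdjoint (Mat n)) (hH₁ : H₁ ∈ skewAdjoint (Mat n)) :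
    (fderiv ℝ (endPoint T H₀ H₁ ρ₀) u).toLinearMap.range =
      tangentSpace ρ₀ (endPoint T H₀ H₁ ρ₀ u) :=
  Submodule.eq_of_le_of_finrank_le (range_fderiv_endPoint_le hT hH₀ hH₁ u)
    ((finrank_tangentSpace_le (endPoint_mem_orbit hT hH₀ hH₁ u)).trans_eq hu.symm)

lemma hasFDerivAt_controlCost (hT : 0 ≤ T) (θ : Mat n) (u : Control T) :
    HasFDerivAt (controlCost T H₀ H₁ ρ₀ θ)
      ((costCLM θ).comp (fderiv ℝ (endPoint T H₀ H₁ ρ₀) u)) u :=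
  (hasFDerivAt_cost θ _).comp u (differentiable_endPoint hT u).hasFDerivAt

lemma IsRegular.isCriticalControl_iff {u : Control T} (hu : IsRegular T H₀ H₁ ρ₀ u)
    (hT : 0 ≤ T) (hH₀ : H₀ ∈ skewAdjoint (Mat n)) (hH₁ : H₁ ∈ skewAdjoint (Mat n)) (θ : Mat n) :
    IsCriticalControl T H₀ H₁ ρ₀ θ u ↔ IsCriticalState ρ₀ θ (endPoint T H₀ H₁ ρ₀ u) := by
  have hderiv := hasFDerivAt_controlCost (H₀ := H₀) (H₁ := H₁) (ρ₀ := ρ₀) hT θ u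
  rw [isCriticalState_iff (endPoint_mem_orbit hT hH₀ hH₁ u),
    ← hu.range_fderiv_endPoint_eq hT hH₀ hH₁]
  constructor
  · rintro hcrit _ ⟨v, rfl⟩
    exact DFunLike.congr_fun (hderiv.unique hcrit) v
  · intro hcrit
    exact hderiv.congr_fderiv (ContinuousLinearMap.ext fun v ↦ hcrit _ ⟨v, rfl⟩)

end RegularControl

end QuantumControl

end

theorem mainTheorem11_general (n : ℕ) (T : ℝ) (hT : 0 ≤ T)
    (H₀ H₁ ρ₀ θ : QuantumControl.Mat n)
    (hH₀ : H₀ ∈ skewAdjoint (QuantumControl.Mat n)) (hH₁ : H₁ ∈ skewAdjoint (QuantumControl.Mat n))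
    (hρ₀ : ρ₀.IsHermitian) (hθ : θ.IsHermitian)
    (u : QuantumControl.Control T) (hu : QuantumControl.IsRegular T H₀ H₁ ρ₀ u) :
    (QuantumControl.IsCriticalControl T H₀ H₁ ρ₀ θ u ↔
      QuantumControl.IsCriticalState ρ₀ θ (QuantumControl.endPoint T H₀ H₁ ρ₀ u)) ∧
    (QuantumControl.IsCriticalState ρ₀ θ (QuantumControl.endPoint T H₀ H₁ ρ₀ u) ↔
      ⁅QuantumControl.endPoint T H₀ H₁ ρ₀ u, θ⁆ = 0) :=
  ⟨hu.isCriticalControl_iff hT hH₀ hH₁ θ,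
    QuantumControl.isCriticalState_iff_lie_eq_zero hρ₀ hθ
      (QuantumControl.endPoint_mem_orbit hT hH₀ hH₁ u)⟩

theorem mainTheorem11 (n : ℕ) (T : ℝ) (hT : 0 < T)
    (H₀ H₁ ρ₀ θ : QuantumControl.Mat n)
    (hH₀ : QuantumControl.IsSu H₀) (hH₁ : QuantumControl.IsSu H₁)
    (hρ₀ : ρ₀.IsHermitian) (hθ : θ.IsHermitian)
    (u : QuantumControl.Control T) (hu : QuantumControl.IsRegular T H₀ H₁ ρ₀ u) :
    (QuantumControl.IsCriticalControl T H₀ H₁ ρ₀ θ u ↔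
      QuantumControl.IsCriticalState ρ₀ θ (QuantumControl.endPoint T H₀ H₁ ρ₀ u)) ∧
    (QuantumControl.IsCriticalState ρ₀ θ (QuantumControl.endPoint T H₀ H₁ ρ₀ u) ↔
      ⁅QuantumControl.endPoint T H₀ H₁ ρ₀ u, θ⁆ = 0) :=
  mainTheorem11_general n T hT.le H₀ H₁ ρ₀ θ (skewAdjoint.mem_iff.2 hH₀.1)
    (skewAdjoint.mem_iff.2 hH₁.1) hρ₀ hθ u hu
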